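/- Let $X$ be a finite set and let $X^*$ be the regular rooted tree whose vertices are the words over $X$, with root the empty word and edges from $w$ to $wx$ ($x\in X$). For $g\in\operatorname{Aut}X^*$ and $w\in X^*$, let $g@w\in\operatorname{Aut}X^*$ be the state of $g$ at $w$, defined by $g(wv)=g(w)\,(g@w)(v)$ for all $v \in X^*$, and let $w*g\in\operatorname{Aut}X^*$ be the automorphism that maps $wv$ to $w\,g(v)$ for all $v \in X^*$ and fixes every vertex that does not have $w$ as a prefix. A homomorphism $\rho:\Gamma\to\operatorname{Aut}X^*$ is called *level-transitive* if $\rho(\Gamma)$ acts transitively on the set $X^n$ of words of length $n$, for every $n\ge0$; *self-similar* if $\rho(\gamma)@w\in\rho(\Gamma)$ for all $\gamma\in\Gamma$ and $w\in X^*$; and *regular branch* if it is injective and there is a subgroup $K\ne1$ of $\rho(\Gamma)$ such that $v*K\le K$ for all $v\in X^*$ and such that, for every $n\ge0$, the subgroup generated by all $v*K$ with $v\in X^n$ has finite index in $\rho(\Gamma)$. **Theorem A.** Let $\Gamma$ be a group, let $X_1,X_2$ be finite sets, and let $\rho_i:\Gamma\to\operatorname{Aut}X_i^*$ ($i=1,2$)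 be two level-transitive, self-similar, regular branch representations of $\Gamma$. Let $\widehat\Gamma$ be the profinite completion of $\Gamma$, let $\overline\Gamma_i$ be the closure of $\rho_i(\Gamma)$ in the profinite group $\operatorname{Aut}X_i^*$, and let $\widehat\Gamma\to\overline\Gamma_i$ be the continuous homomorphism that extends $\rho_i$. Then the congruence kernels coincide as subgroups of $\widehat\Gamma$: $$\ker(\widehat\Gamma\to\overline\Gamma_1)=\ker(\widehat\Gamma\to\overline\Gamma_2).$$ -/

import Mathlib

universe u

namespace SylvanRep

open CategoryTheory

/-- The edges of the regular rooted tree `X^*`. Its vertices are the words over the alphabet `X`,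
its root is the empty word, and there is an edge from each word `w` to each word `wx`, `x ∈ X`.
The level of a vertex is its length. -/
def Edge (X : Type u) (w w' : List X) : Prop := ∃ x : X, w' = w ++ [x]

/-- The automorphism group of the rooted tree `X^*`: permutations of the vertices preserving the
(directed) edges. -/
abbrev TreeAut (X : Type u) : Type u := Edge X ≃r Edge X

section Tree

variable {X : Type u}

theorem TreeAut.map_nil (g : TreeAut X) : g [] = [] := by
  rcases List.eq_nil_or_concat' (g []) with h | ⟨w, x, h⟩
  · exact h
  · have h1 : Edge X (g (g.symm w)) (g []) := ⟨x, by simpa using h⟩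
    obtain ⟨y, hy⟩ := g.map_rel_iff.1 h1
    simp at hy

theorem TreeAut.length_apply (g : TreeAut X) (w : List X) : (g w).length = w.length := by
  induction w using List.reverseRecOn with
  | nil => simp [TreeAut.map_nil]
  | append_singleton w x ih =>
    obtain ⟨y, hy⟩ := g.map_rel_iff.2 (⟨x, rfl⟩ : Edge X w (w ++ [x]))
    simp [hy, ih]

theorem TreeAut.exists_append (g : TreeAut X) (w v : List X) : ∃ v', g (w ++ v) = g w ++ v' := by
  induction v using List.reverseRecOn with
  | nil => exact ⟨[], by simp⟩
  | append_singleton v x ih =>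
    obtain ⟨v', hv'⟩ := ih
    obtain ⟨y, hy⟩ := g.map_rel_iff.2 (⟨x, rfl⟩ : Edge X (w ++ v) (w ++ v ++ [x]))
    exact ⟨v' ++ [y], by rw [← List.append_assoc, hy, hv', List.append_assoc]⟩

/-- The action on words of the state of `g` at `w`. -/
def stateFun (g : TreeAut X) (w v : List X) : List X := (g (w ++ v)).drop w.length

theorem apply_append (g : TreeAut X) (w v : List X) : g (w ++ v) = g w ++ stateFun g w v := by
  obtain ⟨v', hv'⟩ := g.exists_append w v
  rw [stateFun, hv', ← g.length_apply w, List.drop_left]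

/-- The state `g@w` of `g` at the vertex `w`: the automorphism of `X^*` obtained by restricting `g`
to the subtree `w X^* ≅ X^*` rooted at `w`, whose image is the subtree `g(w) X^* ≅ X^*`.
That is, `g (w v) = g(w) (g@w)(v)` for all words `v`. -/
def state (g : TreeAut X) (w : List X) : TreeAut X where
  toFun := stateFun g w
  invFun := stateFun g⁻¹ (g w)
  left_inv v := by
    have h := apply_append g⁻¹ (g w) (stateFun g w v)
    rw [← apply_append, RelIso.inv_apply_self, RelIso.inv_apply_self] at h
    exact (List.append_cancel_left h).symm
  right_inv v := by
    have h := apply_append g⁻¹ (g w) v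
    rw [RelIso.inv_apply_self] at h
    have h2 := apply_append g w (stateFun g⁻¹ (g w) v)
    rw [← h, RelIso.apply_inv_self] at h2
    exact (List.append_cancel_left h2).symm
  map_rel_iff' := by
    intro a b
    have h : Edge X (g (w ++ a)) (g (w ++ b)) ↔ Edge X (w ++ a) (w ++ b) := g.map_rel_iff
    rw [apply_append, apply_append] at h
    simpa [Edge] using h

open Classical in
/-- The action on words of the `w`-translate of `g`. -/
noncomputable def translateFun (w : List X) (g : TreeAut X) (v : List X) : List X :=
  if w <+: v then w ++ g (v.drop w.length) else v

theorem translateFun_append (w : List X) (g : TreeAut X) (v : List X) :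
    translateFun w g (w ++ v) = w ++ g v := by
  simp [translateFun]

theorem translateFun_of_not (w : List X) (g : TreeAut X) {v : List X} (h : ¬ w <+: v) :
    translateFun w g v = v := by
  simp [translateFun, h]

theorem translateFun_mul (w : List X) (g h : TreeAut X) (v : List X) :
    translateFun w (g * h) v = translateFun w g (translateFun w h v) := by
  by_cases hv : w <+: v
  · obtain ⟨v, rfl⟩ := hv
    simp [translateFun_append]
  · simp [translateFun_of_not, hv]

theorem translateFun_one (w : List X) (v : List X) : translateFun w (1 : TreeAut X) v = v := by
  by_cases hv : w <+: v
  · obtain ⟨v, rfl⟩ := hv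
    simp [translateFun_append]
  · simp [translateFun_of_not, hv]

theorem translateFun_edge (w : List X) (g : TreeAut X) {a b : List X} (h : Edge X a b) :
    Edge X (translateFun w g a) (translateFun w g b) := by
  obtain ⟨x, rfl⟩ := h
  by_cases ha : w <+: a
  · obtain ⟨a, rfl⟩ := ha
    obtain ⟨y, hy⟩ := g.map_rel_iff.2 (⟨x, rfl⟩ : Edge X a (a ++ [x]))
    exact ⟨y, by rw [List.append_assoc, translateFun_append, translateFun_append, hy,
      List.append_assoc]⟩
  · rw [translateFun_of_not w g ha]
    refine ⟨x, ?_⟩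
    by_cases hb : w <+: a ++ [x]
    · obtain rfl : w = a ++ [x] := (List.prefix_concat_iff.1 hb).resolve_right ha
      simpa [g.map_nil] using translateFun_append (a ++ [x]) g []
    · exact translateFun_of_not w g hb

/-- The `w`-translate `w*g` of `g`: the automorphism that fixes every vertex outside of the subtree
rooted at `w`, and acts on this subtree `w X^* ≅ X^*` as `g`, that is, `w v ↦ w g(v)`. -/
noncomputable def translate (w : List X) : TreeAut X →* TreeAut X where
  toFun g :=
    { toFun := translateFun w g
      invFun := translateFun w g⁻¹
      left_inv := fun v => by rw [← translateFun_mul, inv_mul_cancel, translateFun_one]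
      right_inv := fun v => by rw [← translateFun_mul, mul_inv_cancel, translateFun_one]
      map_rel_iff' := by
        intro a b
        refine ⟨fun h => ?_, fun h => translateFun_edge w g h⟩
        have h' := translateFun_edge w g⁻¹ h
        simpa only [Equiv.coe_fn_mk, ← translateFun_mul, inv_mul_cancel, translateFun_one] using h' }
  map_one' := RelIso.ext fun v => translateFun_one w v
  map_mul' g h := RelIso.ext fun v => translateFun_mul w g h v

/-- The subgroup `X^n*K` of `Aut X^*` generated by the translates `v*K`, for all vertices `v` of
level `n`. -/
noncomputable def levelTranslate (K : Subgroup (TreeAut X)) (n : ℕ) : Subgroup (TreeAut X) :=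
  ⨆ (v : List X) (_ : v.length = n), K.map (translate v)

/-- The topology on `Aut X^*` of pointwise convergence on the (discrete) set of vertices. The level
stabilizers form a basis of neighbourhoods of the identity when `X` is finite. -/
instance : TopologicalSpace (TreeAut X) :=
  TopologicalSpace.induced (fun (g : TreeAut X) (w : List X) => g w)
    (@Pi.topologicalSpace (List X) (fun _ => List X) fun _ => ⊥)

theorem isOpen_setOf_apply_eq (w w' : List X) : IsOpen {g : TreeAut X | g w = w'} := by
  let _ : TopologicalSpace (List X) := ⊥
  have _ : DiscreteTopology (List X) := ⟨rfl⟩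
  have hc : Continuous fun g : TreeAut X => g w :=
    (continuous_apply w).comp continuous_induced_dom
  exact (isOpen_discrete {w'}).preimage hc

theorem continuous_iff_apply {Y : Type*} [TopologicalSpace Y] (f : Y → TreeAut X) :
    Continuous f ↔ ∀ w w', IsOpen {y | f y w = w'} := by
  refine ⟨fun h w w' => (isOpen_setOf_apply_eq w w').preimage h, fun h => ?_⟩
  let _ : TopologicalSpace (List X) := ⊥
  have _ : DiscreteTopology (List X) := ⟨rfl⟩
  refine continuous_induced_rng.2 (continuous_pi fun w => ?_)
  exact continuous_discrete_rng.2 fun w' => h w w'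

instance : IsTopologicalGroup (TreeAut X) where
  continuous_mul := by
    refine (continuous_iff_apply _).2 fun w w' => ?_
    have : {y : TreeAut X × TreeAut X | (y.1 * y.2) w = w'} =
        ⋃ v, {g : TreeAut X | g v = w'} ×ˢ {g : TreeAut X | g w = v} := by
      ext ⟨g, h⟩
      simp
    rw [this]
    exact isOpen_iUnion fun v => (isOpen_setOf_apply_eq v w').prod (isOpen_setOf_apply_eq w v)
  continuous_inv := by
    refine (continuous_iff_apply _).2 fun w w' => ?_
    have : {g : TreeAut X | g⁻¹ w = w'} = {g : TreeAut X | g w' = w} := by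
      ext g
      constructor
      · rintro rfl
        exact RelIso.apply_inv_self g w
      · rintro rfl
        exact RelIso.inv_apply_self g w'
    rw [this]
    exact isOpen_setOf_apply_eq w' w

instance : TotallyDisconnectedSpace (TreeAut X) := by
  let _ : TopologicalSpace (List X) := ⊥
  have _ : DiscreteTopology (List X) := ⟨rfl⟩
  have hc : Continuous fun (g : TreeAut X) (w : List X) => g w := continuous_induced_dom
  refine ⟨isTotallyDisconnected_of_image hc.continuousOn ?_
    (isTotallyDisconnected_of_totallyDisconnectedSpace _)⟩
  exact fun g h e => RelIso.ext fun w => congrFun e w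

instance [Finite X] : CompactSpace (TreeAut X) := by
  let _ : TopologicalSpace (List X) := ⊥
  have _ : DiscreteTopology (List X) := ⟨rfl⟩
  -- the map `g ↦ (g, g⁻¹)` is inducing, with closed image inside a compact product
  let F : TreeAut X → (List X → List X) × (List X → List X) :=
    fun g => (fun w => g w, fun w => g⁻¹ w)
  have hc : Continuous fun (g : TreeAut X) (w : List X) => g w := continuous_induced_dom
  have hF : Topology.IsInducing F := by
    have hFc : Continuous F := hc.prodMk (hc.comp continuous_inv)
    refine ⟨le_antisymm hFc.le_induced ?_⟩
    have h := @Continuous.comp _ _ _ (TopologicalSpace.induced F _) _ _ F Prod.fst continuous_fst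
      continuous_induced_dom
    exact continuous_iff_le_induced.1 h
  let C : Set ((List X → List X) × (List X → List X)) :=
    ⋂ (a : List X) (b : List X),
      {p | (p.1 a = b ↔ p.2 b = a) ∧ (Edge X (p.1 a) (p.1 b) ↔ Edge X a b)}
  have hC : IsClosed C := by
    refine isClosed_iInter fun a => isClosed_iInter fun b => ?_
    have h : Continuous fun p : (List X → List X) × (List X → List X) =>
        (p.1 a, p.1 b, p.2 b) := by fun_prop
    exact (isClosed_discrete
      {q : List X × List X × List X |
        (q.1 = b ↔ q.2.2 = a) ∧ (Edge X q.1 q.2.1 ↔ Edge X a b)}).preimage h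
  let L : Set (List X → List X) := Set.univ.pi fun w => {v | v.length = w.length}
  have hL : IsCompact L := isCompact_univ_pi fun w => (List.finite_length_eq X w.length).isCompact
  have himage : F '' Set.univ = C ∩ L ×ˢ L := by
    ext ⟨p, q⟩
    constructor
    · rintro ⟨g, -, hg⟩
      obtain ⟨rfl, rfl⟩ := Prod.mk.inj hg
      refine ⟨?_, fun w _ => g.length_apply w, fun w _ => g⁻¹.length_apply w⟩
      refine Set.mem_iInter.2 fun a => Set.mem_iInter.2 fun b => ⟨⟨?_, ?_⟩, g.map_rel_iff⟩
      · rintro rfl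
        exact RelIso.inv_apply_self g a
      · rintro rfl
        exact RelIso.apply_inv_self g b
    · rintro ⟨h, -⟩
      have h' : ∀ a b, (p a = b ↔ q b = a) ∧ (Edge X (p a) (p b) ↔ Edge X a b) :=
        fun a b => Set.mem_iInter.1 (Set.mem_iInter.1 h a) b
      exact ⟨⟨⟨p, q, fun w => (h' w _).1.1 rfl, fun w => (h' _ w).1.2 rfl⟩, (h' _ _).2⟩,
        trivial, rfl⟩
  refine ⟨hF.isCompact_iff.2 ?_⟩
  rw [himage]
  exact (hL.prod hL).inter_left hC

end Tree

section Representation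

variable {Γ X : Type u} [Group Γ]

/-- A representation `ρ : Γ → Aut X^*` is level-transitive if `Γ` acts transitively on each level
of the tree. -/
def IsLevelTransitive (ρ : Γ →* TreeAut X) : Prop :=
  ∀ v w : List X, v.length = w.length → ∃ γ : Γ, ρ γ v = w

/-- A representation `ρ : Γ → Aut X^*` is self-similar if all states of elements of its image
belong to its image. -/
def IsSelfSimilar (ρ : Γ →* TreeAut X) : Prop :=
  ∀ (γ : Γ) (w : List X), state (ρ γ) w ∈ ρ.range

/-- A representation `ρ : Γ → Aut X^*` is regular branch if it is faithful and, `Γ` being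
identified with its image, there is a subgroup `K ≠ 1` of `Γ` with `v*K ≤ K` for every vertex `v`
and such that `X^n*K` has finite index in `Γ` for every `n ≥ 0`. -/
def IsRegularBranch (ρ : Γ →* TreeAut X) : Prop :=
  Function.Injective ρ ∧
    ∃ K : Subgroup (TreeAut X), K ≤ ρ.range ∧ K ≠ ⊥ ∧
      (∀ v : List X, K.map (translate v) ≤ K) ∧
      ∀ n : ℕ, ((levelTranslate K n).subgroupOf ρ.range).FiniteIndex

/-- The profinite completion `Γ̂` of `Γ`. -/
abbrev profiniteCompletion (Γ : Type u) [Group Γ] : ProfiniteGrp.{u} :=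
  ProfiniteGrp.ProfiniteCompletion.completion (GrpCat.of Γ)

variable [Finite X]

/-- The congruence completion `Γ̄`: the closure of `ρ(Γ)` in the profinite group `Aut X^*`. -/
def congruenceCompletion (ρ : Γ →* TreeAut X) : ProfiniteGrp.{u} :=
  haveI : CompactSpace ρ.range.topologicalClosure :=
    isCompact_iff_compactSpace.1 ρ.range.isClosed_topologicalClosure.isCompact
  ProfiniteGrp.of ρ.range.topologicalClosure

/-- The map `Γ → Γ̄` given by `ρ`. -/
def toCongruenceCompletion (ρ : Γ →* TreeAut X) : Γ →* congruenceCompletion ρ :=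
  ρ.codRestrict ρ.range.topologicalClosure
    fun γ => ρ.range.le_topologicalClosure ⟨γ, rfl⟩

/-- The natural map `Γ̂ → Γ̄`: the unique continuous homomorphism extending `Γ → Γ̄`. -/
noncomputable def completionMap (ρ : Γ →* TreeAut X) :
    profiniteCompletion Γ ⟶ congruenceCompletion ρ :=
  ProfiniteGrp.ProfiniteCompletion.lift (GrpCat.ofHom (toCongruenceCompletion ρ))

/-- The congruence kernel `ker(Γ̂ → Γ̄)`, a subgroup of the profinite completion of `Γ`. -/
noncomputable def congruenceKernel (ρ : Γ →* TreeAut X) : Subgroup (profiniteCompletion Γ) :=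
  (completionMap ρ).hom.toMonoidHom.ker

end Representation

end SylvanRep

/-!
An element of `Γ̂` lies in the congruence kernel of `ρ` exactly if its image in `Aut X^*` fixes every
vertex. By density of `Γ` in `Γ̂`, two congruence kernels coincide as soon as the two actions define
the same congruence topology on `Γ`, that is, as soon as the stabilizer in `Γ` of any vertex for one
action contains the stabilizer of some vertex for the other one
(`congruenceKernel_le_of_forall_vertex`).

For a vertex `v` of the first tree let `Rist₁(v) ≤ Γ` be the subgroup of elements acting trivially
outside of the subtree at `v`, and define `Rist₂(w)` in the same way for the second tree. Say that
`v` *moves* `w` if some element of `Rist₁(v)` moves `w`. This relation is `Γ`-equivariant.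

* A vertex `w` is moved by at most one vertex `v` of each level (`eq_of_moves`). This is the double
  commutator trick: if `g ∈ Rist₁(v)` moves `w`, and `x, y ∈ Rist₂(w)` fix `v`, then `g x g⁻¹`
  commutes with `x` and `y`, so that `[x⁻¹, y] = [[g, x], y] ∈ Rist₁(v)`. If a second vertex `v'` of
  the same level as `v` also moves `w`, then `[x⁻¹, y] ∈ Rist₁(v) ∩ Rist₁(v') = 1` whenever `x, y`
  fix both `v` and `v'`. But the intersection of `Rist₂(w)` with a subgroup of finite index is
  never abelian (`IsRegularBranch.exists_not_commute`).
* Since `Rist₁(v) ≠ 1`, and since the second action is faithful, `v` moves some vertex `w`. If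
  `γ ∈ Γ` fixes `w`, then both `v` and `γ v` move `w`, so `γ v = v`: the stabilizer of `w` is
  contained in the stabilizer of `v` (`exists_vertex_stabilizer_le`).
-/

namespace SylvanRep

section Tree

variable {X : Type u}

theorem TreeAut.prefix_apply_iff (g : TreeAut X) {v u : List X} : g v <+: g u ↔ v <+: u := by
  have key (h : TreeAut X) {a b : List X} (hab : a <+: b) : h a <+: h b := by
    obtain ⟨t, rfl⟩ := hab
    obtain ⟨t', ht'⟩ := h.exists_append a t
    exact ⟨t', ht'.symm⟩
  refine ⟨fun h => ?_, key g⟩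
  have h' := key g⁻¹ h
  rwa [RelIso.inv_apply_self, RelIso.inv_apply_self] at h'

theorem not_prefix_of_prefix {v w u : List X} (hl : v.length = w.length) (hne : v ≠ w)
    (hv : v <+: u) : ¬ w <+: u := fun hw =>
  hne ((List.prefix_of_prefix_length_le hv hw hl.le).eq_of_length hl)

theorem translate_apply_append (w : List X) (g : TreeAut X) (v : List X) :
    translate w g (w ++ v) = w ++ g v :=
  translateFun_append w g v

theorem translate_apply_of_not (w : List X) (g : TreeAut X) {v : List X} (h : ¬ w <+: v) :
    translate w g v = v :=
  translateFun_of_not w g h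

/-- The stabilizer of a vertex in `Aut X^*`. -/
def vertexStabilizer (v : List X) : Subgroup (TreeAut X) where
  carrier := {g | g v = v}
  one_mem' := rfl
  mul_mem' {a b} ha hb := by
    change a (b v) = v
    rw [show b v = v from hb, show a v = v from ha]
  inv_mem' {a} ha := by
    change a⁻¹ v = v
    conv_lhs => rw [← show a v = v from ha]
    exact RelIso.inv_apply_self a v

instance [Finite X] (v : List X) : (vertexStabilizer v).FiniteIndex :=
  have := Subgroup.quotient_finite_of_isOpen (vertexStabilizer v) (isOpen_setOf_apply_eq v v)
  Subgroup.finiteIndex_of_finite_quotient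

instance [Finite X] {Γ : Type*} [Group Γ] (ρ : Γ →* TreeAut X) (v : List X) :
    ((vertexStabilizer v).comap ρ).FiniteIndex := by
  rw [Subgroup.finiteIndex_iff, Subgroup.index_comap]
  exact ((vertexStabilizer v).subgroupOf ρ.range).index_ne_zero_of_finite

end Tree

/-! ### Rigid stabilizers -/

section Rigid

variable {Γ X : Type u} [Group Γ] {ρ : Γ →* TreeAut X}

/-- The rigid stabilizer of the vertex `v`, as a subgroup of `Γ`: the elements that fix every vertex
outside of the subtree rooted at `v`. -/
def rigidStabilizer (ρ : Γ →* TreeAut X) (v : List X) : Subgroup Γ where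
  carrier := {γ | ∀ u, ¬ v <+: u → ρ γ u = u}
  one_mem' u _ := by rw [map_one]; rfl
  mul_mem' {a b} ha hb u hu := by
    rw [map_mul, RelIso.mul_apply, hb u hu, ha u hu]
  inv_mem' {a} ha u hu := by
    rw [map_inv]
    conv_lhs => rw [← ha u hu]
    exact RelIso.inv_apply_self _ u

theorem rigidStabilizer_anti {v w : List X} (h : v <+: w) :
    rigidStabilizer ρ w ≤ rigidStabilizer ρ v :=
  fun _ hγ u hu => hγ u fun hw => hu (h.trans hw)

theorem apply_eq_self_of_mem {v : List X} {γ : Γ} (hγ : γ ∈ rigidStabilizer ρ v) : ρ γ v = v := by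
  by_contra hne
  have hl : (ρ γ v).length = v.length := TreeAut.length_apply _ v
  exact hne ((ρ γ).injective (hγ _ (not_prefix_of_prefix hl hne (List.prefix_refl _))))

theorem conj_mem_rigidStabilizer {v : List X} {γ : Γ} (hγ : γ ∈ rigidStabilizer ρ v) (δ : Γ) :
    δ * γ * δ⁻¹ ∈ rigidStabilizer ρ (ρ δ v) := by
  intro u hu
  obtain ⟨u, rfl⟩ := (ρ δ).surjective u
  rw [TreeAut.prefix_apply_iff] at hu
  rw [map_mul, map_mul, map_inv, RelIso.mul_apply, RelIso.mul_apply, RelIso.inv_apply_self, hγ u hu]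

theorem mul_comm_of_mem_rigidStabilizer (hρ : Function.Injective ρ) {v w : List X}
    (hl : v.length = w.length) (hne : v ≠ w) {γ δ : Γ} (hγ : γ ∈ rigidStabilizer ρ v)
    (hδ : δ ∈ rigidStabilizer ρ w) : γ * δ = δ * γ := by
  refine hρ (RelIso.ext fun u => ?_)
  rw [map_mul, map_mul, RelIso.mul_apply, RelIso.mul_apply]
  by_cases hv : v <+: u
  · have hv' : v <+: ρ γ u := by
      simpa only [apply_eq_self_of_mem hγ] using (ρ γ).prefix_apply_iff.2 hv
    rw [hδ u (not_prefix_of_prefix hl hne hv), hδ _ (not_prefix_of_prefix hl hne hv')]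
  · rw [hγ u hv]
    refine hγ _ fun hv' => hv ((ρ δ).prefix_apply_iff.1 ?_)
    rwa [← hδ v fun hw => hne (hw.eq_of_length hl.symm).symm] at hv'

theorem eq_one_of_mem_rigidStabilizer (hρ : Function.Injective ρ) {v w : List X}
    (hl : v.length = w.length) (hne : v ≠ w) {γ : Γ} (hv : γ ∈ rigidStabilizer ρ v)
    (hw : γ ∈ rigidStabilizer ρ w) : γ = 1 := by
  refine hρ (RelIso.ext fun u => ?_)
  rw [map_one]
  by_cases h : v <+: u
  · exact hw u (not_prefix_of_prefix hl hne h)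
  · exact hv u h

theorem exists_apply_ne (hρ : Function.Injective ρ) {γ : Γ} (h : γ ≠ 1) : ∃ u, ρ γ u ≠ u := by
  by_contra! hf
  exact h (hρ (RelIso.ext fun u => by rw [hf u, map_one]; rfl))

/-- If `k ∈ K` moves a vertex `z` of minimal level, then the translates of `k` to vertices of
different levels have different minimal levels of moved vertices, so they are distinct. -/
theorem IsRegularBranch.infinite_rigidStabilizer (hb : IsRegularBranch ρ) (v : List X) :
    Infinite (rigidStabilizer ρ v) := by
  obtain ⟨-, K, hK, hne, htr, -⟩ := hb
  obtain ⟨⟨k, hk⟩, hk1⟩ := K.ne_bot_iff_exists_ne_one.1 hne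
  have hmove : ∃ n, ∃ z : List X, z.length = n ∧ k z ≠ z := by
    by_contra! hf
    exact hk1 (Subtype.ext (RelIso.ext fun z => hf _ z rfl))
  classical
  obtain ⟨z, hzl, hz⟩ := Nat.find_spec hmove
  have hmin : ∀ z' : List X, z'.length < z.length → k z' = z' := fun z' h => by
    by_contra h'
    exact Nat.find_min hmove (hzl ▸ h) ⟨z', rfl, h'⟩
  obtain ⟨y, -⟩ : ∃ y, y ∈ z :=
    List.exists_mem_of_ne_nil z fun h => hz (by rw [h, TreeAut.map_nil])
  have hex (i : ℕ) : ∃ γ : Γ, ρ γ = translate (v ++ List.replicate i y) k :=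
    hK (htr _ ⟨_, hk, rfl⟩)
  choose f hf using hex
  have hmem (i : ℕ) : f i ∈ rigidStabilizer ρ v :=
    rigidStabilizer_anti (List.prefix_append v _) fun u hu => by
      rw [hf, translate_apply_of_not _ _ hu]
  refine Infinite.of_injective (fun i => (⟨f i, hmem i⟩ : rigidStabilizer ρ v)) ?_
  refine Function.Injective.of_lt_imp_ne fun i j hij he => ?_
  have he' : f i = f j := congrArg Subtype.val he
  have h1 : ρ (f i) (v ++ List.replicate i y ++ z) ≠ v ++ List.replicate i y ++ z := by
    rw [hf, translate_apply_append]
    exact fun h => hz (List.append_cancel_left h)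
  refine h1 ?_
  rw [he', hf]
  by_cases hp : v ++ List.replicate j y <+: v ++ List.replicate i y ++ z
  · obtain ⟨t, ht⟩ := hp
    have hlen := congrArg List.length ht
    simp only [List.length_append, List.length_replicate] at hlen
    rw [← ht, translate_apply_append, hmin t (by omega)]
  · exact translate_apply_of_not _ _ hp

theorem IsRegularBranch.exists_mem_ne_one (hb : IsRegularBranch ρ) (v : List X) (H : Subgroup Γ)
    [H.FiniteIndex] : ∃ γ ∈ rigidStabilizer ρ v, γ ∈ H ∧ γ ≠ 1 := by
  have := hb.infinite_rigidStabilizer v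
  obtain ⟨a, b, hab, he⟩ := Finite.exists_ne_map_eq_of_infinite
    fun γ : rigidStabilizer ρ v => (QuotientGroup.mk (γ : Γ) : Γ ⧸ H)
  refine ⟨a⁻¹ * b, mul_mem (inv_mem a.2) b.2, QuotientGroup.eq.1 he, fun h => hab ?_⟩
  exact Subtype.ext (inv_mul_eq_one.1 h)

/-- If `x ∈ Rist(w)` moves a vertex `u`, then a nontrivial `y ∈ Rist(u) ∩ Rist(w)` does not commute
with `x`, because `x y x⁻¹` acts on the different subtree rooted at `x(u)`. -/
theorem IsRegularBranch.exists_not_commute (hb : IsRegularBranch ρ) (w : List X) (H : Subgroup Γ)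
    [H.FiniteIndex] : ∃ x ∈ rigidStabilizer ρ w, ∃ y ∈ rigidStabilizer ρ w,
      x ∈ H ∧ y ∈ H ∧ x * y ≠ y * x := by
  obtain ⟨x, hx, hxH, hx1⟩ := hb.exists_mem_ne_one w H
  obtain ⟨u, hu⟩ := exists_apply_ne hb.1 hx1
  obtain ⟨y, hy, hyH, hy1⟩ := hb.exists_mem_ne_one u H
  have hwu : w <+: u := by
    by_contra h
    exact hu (hx u h)
  refine ⟨x, hx, y, rigidStabilizer_anti hwu hy, hxH, hyH, fun hc => hy1 ?_⟩
  have hy' := conj_mem_rigidStabilizer hy x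
  rw [hc, mul_inv_cancel_right] at hy'
  exact eq_one_of_mem_rigidStabilizer hb.1 (TreeAut.length_apply _ u) hu hy' hy

end Rigid

/-! ### Comparison of two actions -/

section Comparison

variable {Γ X Y : Type u} [Group Γ] {ρ : Γ →* TreeAut X} {σ : Γ →* TreeAut Y}

/-- The vertex `v` of the first tree moves the vertex `w` of the second tree if some element of the
rigid stabilizer of `v` moves `w`. -/
def Moves (ρ : Γ →* TreeAut X) (σ : Γ →* TreeAut Y) (v : List X) (w : List Y) : Prop :=
  ∃ γ ∈ rigidStabilizer ρ v, σ γ w ≠ w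

theorem Moves.map {v : List X} {w : List Y} (h : Moves ρ σ v w) (δ : Γ) :
    Moves ρ σ (ρ δ v) (σ δ w) := by
  obtain ⟨γ, hγ, hw⟩ := h
  refine ⟨δ * γ * δ⁻¹, conj_mem_rigidStabilizer hγ δ, ?_⟩
  rw [map_mul, map_mul, map_inv, RelIso.mul_apply, RelIso.mul_apply, RelIso.inv_apply_self]
  exact fun h => hw ((σ δ).injective h)

theorem exists_moves (hb : IsRegularBranch ρ) (hσ : Function.Injective σ) (v : List X) :
    ∃ w : List Y, Moves ρ σ v w := by
  obtain ⟨γ, hγ, -, hγ1⟩ := hb.exists_mem_ne_one v ⊤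
  obtain ⟨w, hw⟩ := exists_apply_ne hσ hγ1
  exact ⟨w, γ, hγ, hw⟩

/-- The double commutator trick: `[[g, x], y] = [x⁻¹, y]` if `g x g⁻¹` commutes with `x` and `y`. -/
theorem commutator_mem_of_moves (hσ : Function.Injective σ) {v : List X} {w : List Y}
    (h : Moves ρ σ v w) {x y : Γ} (hx : x ∈ rigidStabilizer σ w) (hy : y ∈ rigidStabilizer σ w)
    (hxv : ρ x v = v) (hyv : ρ y v = v) : x⁻¹ * y * x * y⁻¹ ∈ rigidStabilizer ρ v := by
  obtain ⟨g, hg, hgw⟩ := h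
  have hc : g * (x * g⁻¹ * x⁻¹) ∈ rigidStabilizer ρ v := by
    have := conj_mem_rigidStabilizer (inv_mem hg) x
    rw [hxv] at this
    exact mul_mem hg this
  have hcy := conj_mem_rigidStabilizer hc y
  rw [hyv] at hcy
  have hx' := conj_mem_rigidStabilizer hx g
  have hl : (σ g w).length = w.length := TreeAut.length_apply _ w
  have e1 : Commute (g * x * g⁻¹) x := mul_comm_of_mem_rigidStabilizer hσ hl hgw hx' hx
  have e2 : Commute (g * x * g⁻¹) y := mul_comm_of_mem_rigidStabilizer hσ hl hgw hx' hy
  have e3 : g * (x * g⁻¹ * x⁻¹) * (y * (g * (x * g⁻¹ * x⁻¹)) * y⁻¹)⁻¹ =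
      x⁻¹ * y * x * y⁻¹ := by
    have hz : g * (x * g⁻¹ * x⁻¹) = g * x * g⁻¹ * x⁻¹ := by group
    rw [hz]
    generalize g * x * g⁻¹ = z at e1 e2
    have e4 : Commute z (x⁻¹ * y * x * y⁻¹) :=
      ((e1.inv_right.mul_right e2).mul_right e1).mul_right e2.inv_right
    calc z * x⁻¹ * (y * (z * x⁻¹) * y⁻¹)⁻¹ = z * (x⁻¹ * y * x) * (y * z)⁻¹ := by group
      _ = z * (x⁻¹ * y * x) * (z * y)⁻¹ := by rw [e2.eq]
      _ = z * (x⁻¹ * y * x * y⁻¹) * z⁻¹ := by group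
      _ = x⁻¹ * y * x * y⁻¹ := by rw [e4.eq, mul_inv_cancel_right]
  rw [← e3]
  exact mul_mem hc (inv_mem hcy)

theorem eq_of_moves [Finite X] (hρ : Function.Injective ρ) (hb : IsRegularBranch σ)
    {v v' : List X} {w : List Y} (hl : v.length = v'.length) (hv : Moves ρ σ v w)
    (hv' : Moves ρ σ v' w) : v = v' := by
  by_contra hne
  obtain ⟨x, hx, y, hy, ⟨hxv, hxv'⟩, ⟨hyv, hyv'⟩, hxy⟩ := hb.exists_not_commute w
    ((vertexStabilizer v).comap ρ ⊓ (vertexStabilizer v').comap ρ)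
  have h := eq_one_of_mem_rigidStabilizer hρ hl hne
    (commutator_mem_of_moves hb.1 hv hx hy hxv hyv)
    (commutator_mem_of_moves hb.1 hv' hx hy hxv' hyv')
  refine hxy ?_
  rw [mul_inv_eq_one, mul_assoc, inv_mul_eq_iff_eq_mul] at h
  exact h.symm

theorem exists_vertex_stabilizer_le [Finite X] (hbρ : IsRegularBranch ρ) (hbσ : IsRegularBranch σ)
    (v : List X) : ∃ w : List Y, ∀ γ : Γ, σ γ w = w → ρ γ v = v := by
  obtain ⟨w, hw⟩ := exists_moves hbρ hbσ.1 v
  refine ⟨w, fun γ hγ => ?_⟩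
  have h := hw.map γ
  rw [hγ] at h
  exact eq_of_moves hbρ.1 hbσ (TreeAut.length_apply _ v) h hw

end Comparison

/-! ### Congruence kernels -/

section Kernel

variable {Γ X Y : Type u} [Group Γ] [Finite X] [Finite Y]

/-- The continuous homomorphism `Γ̂ → Γ̄ ≤ Aut X^*`. -/
noncomputable def completionAction (ρ : Γ →* TreeAut X) (a : profiniteCompletion Γ) : TreeAut X :=
  Subtype.val (p := fun g => g ∈ ρ.range.topologicalClosure) (completionMap ρ a)

theorem continuous_completionAction (ρ : Γ →* TreeAut X) : Continuous (completionAction ρ) :=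
  continuous_subtype_val.comp (completionMap ρ).hom.continuous_toFun

theorem completionAction_etaFn (ρ : Γ →* TreeAut X) (γ : Γ) :
    completionAction ρ (ProfiniteGrp.ProfiniteCompletion.etaFn (GrpCat.of Γ) γ) = ρ γ := by
  have h := CategoryTheory.ConcreteCategory.congr_hom (ProfiniteGrp.ProfiniteCompletion.lift_eta
    (GrpCat.ofHom (toCongruenceCompletion ρ))) γ
  exact congrArg (Subtype.val (p := fun g => g ∈ ρ.range.topologicalClosure)) h

theorem mem_congruenceKernel {ρ : Γ →* TreeAut X} {a : profiniteCompletion Γ} :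
    a ∈ congruenceKernel ρ ↔ ∀ v, completionAction ρ a v = v :=
  ⟨fun h v => congrArg (fun g : ρ.range.topologicalClosure => (g : TreeAut X) v)
    (MonoidHom.mem_ker.1 h), fun h => MonoidHom.mem_ker.2 (Subtype.ext (RelIso.ext h))⟩

theorem congruenceKernel_le_of_forall_vertex {ρ : Γ →* TreeAut X} {σ : Γ →* TreeAut Y}
    (h : ∀ v : List X, ∃ w : List Y, ∀ γ : Γ, σ γ w = w → ρ γ v = v) :
    congruenceKernel σ ≤ congruenceKernel ρ := by
  intro a ha
  rw [mem_congruenceKernel] at ha ⊢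
  intro v
  obtain ⟨w, hw⟩ := h v
  by_contra hav
  have hV : IsOpen {b | completionAction ρ b v = completionAction ρ a v} :=
    (isOpen_setOf_apply_eq v _).preimage (continuous_completionAction ρ)
  have hW : IsOpen {b | completionAction σ b w = w} :=
    (isOpen_setOf_apply_eq w w).preimage (continuous_completionAction σ)
  obtain ⟨γ, hγV, hγW⟩ := (ProfiniteGrp.ProfiniteCompletion.denseRange
    (GrpCat.of Γ)).exists_mem_open (hV.inter hW) ⟨a, rfl, ha w⟩
  rw [Set.mem_ofPred_eq, completionAction_etaFn] at hγV hγW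
  exact hav (hγV.symm.trans (hw γ hγW))

end Kernel

end SylvanRep

theorem theoremA {Γ X₁ X₂ : Type u} [Group Γ] [Finite X₁] [Finite X₂]
    (ρ₁ : Γ →* SylvanRep.TreeAut X₁) (ρ₂ : Γ →* SylvanRep.TreeAut X₂)
    (ht₁ : SylvanRep.IsLevelTransitive ρ₁) (ht₂ : SylvanRep.IsLevelTransitive ρ₂)
    (hs₁ : SylvanRep.IsSelfSimilar ρ₁) (hs₂ : SylvanRep.IsSelfSimilar ρ₂)
    (hb₁ : SylvanRep.IsRegularBranch ρ₁) (hb₂ : SylvanRep.IsRegularBranch ρ₂) :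
    SylvanRep.congruenceKernel ρ₁ = SylvanRep.congruenceKernel ρ₂ := by
  exact le_antisymm
    (SylvanRep.congruenceKernel_le_of_forall_vertex
      (SylvanRep.exists_vertex_stabilizer_le hb₂ hb₁))
    (SylvanRep.congruenceKernel_le_of_forall_vertex
      (SylvanRep.exists_vertex_stabilizer_le hb₁ hb₂))
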